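/- All monoids are commutative. In an ordered monoid $S$ write $x\ll y$ if for every increasing sequence $(z_n)_{n\in\mathbb N}$ in $S$ that has a supremum $\sup_n z_n\ge y$ there is $k$ with $z_k\ge x$. Consider the axioms: (O1) every increasing sequence in $S$ has a supremum; (O2) every $x\in S$ is the supremum of a $\ll$-increasing sequence; (O3) $x'\ll x$ and $y'\ll y$ imply $x'+y'\ll x+y$; (O4) $\sup_n x_n+\sup_n y_n=\sup_n(x_n+y_n)$ for increasing sequences; (PC) if $t\ge 0$ and $s\le t$, then $s+t\ge 0$; (PD) for every $s$ there is $p$ with $s+p\ge 0$; (S0) $s+t=0$ implies $s=t=0$. Let $\mathrm{Cu}$ be the category whose objects are the positively ordered monoids satisfying (O1)–(O4), and $\mathrm{Cu}^*$ the category whose objects are the ordered monoids with $0\ll 0$ satisfying (O1)–(O4), (PC), (PD), (S0); in both categories the morphisms are the ordered monoid morphisms that preserve $\ll$ and suprema of increasing sequences. Let $\mathrm{Cu}^*_{\max}\subseteq \mathrm{Cu}^*$ be the full subcategory of the objects that have a maximal element. For $S\in\mathrm{Cu}^*$ let $S_+:=\{s\in S\mid 0\le s\}$ and let $S_{\max}$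 be the set of maximal elements of $S$. If $S_{\max}\neq\emptyset$, then $S_{\max}$ is an abelian group under the addition of $S$, whose neutral element $e_{S_{\max}}$ is the largest element of $S_+$. **Theorem.** There are functors $$\nu_+:\mathrm{Cu}^*\to\mathrm{Cu},\quad S\mapsto S_+,\ \alpha\mapsto\alpha_+,\qquad\qquad \nu_{\max}:\mathrm{Cu}^*_{\max}\to\mathrm{AbGp},\quad S\mapsto S_{\max},\ \alpha\mapsto\alpha_{\max},$$ where, for $\alpha:S\to T$, the morphism $\alpha_+:S_+\to T_+$ is the restriction of $\alpha$ and $\alpha_{\max}:S_{\max}\to T_{\max}$ is given by $\alpha_{\max}(x):=\alpha(x)+e_{T_{\max}}$. Both functors preserve inductive limits, i.e. colimits indexed by (small, non-empty) directed sets. -/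

import Mathlib

open CategoryTheory CategoryTheory.Limits

universe u

namespace CuStarTheory

/-- The way-below (compact-containment) relation `x ≪ y`. -/
def WayBelow {S : Type u} [Preorder S] (x y : S) : Prop :=
  ∀ z : ℕ → S, Monotone z → ∀ s, IsLUB (Set.range z) s → y ≤ s → ∃ k, x ≤ z k

/-- The order-theoretic axioms (O1)-(O4) for a (commutative) monoid with a partial order. -/
class CuntzAxioms (S : Type u) [AddCommMonoid S] [PartialOrder S] : Prop where
  o1 : ∀ z : ℕ → S, Monotone z → ∃ s, IsLUB (Set.range z) s
  o2 : ∀ x : S, ∃ z : ℕ → S, (∀ n, WayBelow (z n) (z (n + 1))) ∧ IsLUB (Set.range z) x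
  o3 : ∀ x' x y' y : S, WayBelow x' x → WayBelow y' y → WayBelow (x' + y') (x + y)
  o4 : ∀ x y : ℕ → S, Monotone x → Monotone y → ∀ s t : S,
    IsLUB (Set.range x) s → IsLUB (Set.range y) t → IsLUB (Set.range fun n => x n + y n) (s + t)

/-- Abstract Cuntz semigroups: positively ordered monoids satisfying (O1)-(O4). -/
class IsCuSemigroup (S : Type u) [AddCommMonoid S] [PartialOrder S] : Prop
    extends IsOrderedAddMonoid S, CuntzAxioms S where
  zero_le : ∀ x : S, 0 ≤ x

/-- Abstract `Cu*`-semigroups: ordered monoids with compact neutral element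
satisfying (O1)-(O4), (PC), (PD) and (S0). -/
class IsCuStarSemigroup (S : Type u) [AddCommMonoid S] [PartialOrder S] : Prop
    extends IsOrderedAddMonoid S, CuntzAxioms S where
  zero_compact : WayBelow (0 : S) 0
  pc : ∀ s t : S, 0 ≤ t → s ≤ t → 0 ≤ s + t
  pd : ∀ s : S, ∃ p : S, 0 ≤ s + p
  s0 : ∀ s t : S, s + t = 0 → s = 0 ∧ t = 0

/-- Ordered monoid morphisms that preserve the way-below relation and suprema of increasing
sequences. These are the morphisms of both `Cu` and `Cu*`. -/
structure CuMorphism (S T : Type u) [AddCommMonoid S] [PartialOrder S]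
    [AddCommMonoid T] [PartialOrder T] extends S →+o T where
  map_wayBelow' : ∀ x y : S, WayBelow x y → WayBelow (toFun x) (toFun y)
  map_isLUB' : ∀ z : ℕ → S, Monotone z → ∀ s : S, IsLUB (Set.range z) s →
    IsLUB (Set.range fun n => toFun (z n)) (toFun s)

namespace CuMorphism

variable {S T V : Type u} [AddCommMonoid S] [PartialOrder S] [AddCommMonoid T] [PartialOrder T]
  [AddCommMonoid V] [PartialOrder V]

instance : FunLike (CuMorphism S T) S T where
  coe f := f.toFun
  coe_injective f g h := by
    obtain ⟨⟨⟨⟨f, _⟩, _⟩, _⟩, _, _⟩ := f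
    obtain ⟨⟨⟨⟨g, _⟩, _⟩, _⟩, _, _⟩ := g
    obtain rfl : f = g := h
    rfl

@[ext] theorem ext {f g : CuMorphism S T} (h : ∀ x, f x = g x) : f = g := DFunLike.ext f g h

theorem map_zero (f : CuMorphism S T) : f 0 = 0 := f.map_zero'
theorem map_add (f : CuMorphism S T) (x y : S) : f (x + y) = f x + f y := f.map_add' x y
theorem monotone (f : CuMorphism S T) : Monotone f := f.monotone'
theorem map_wayBelow (f : CuMorphism S T) {x y : S} (h : WayBelow x y) :
    WayBelow (f x) (f y) := f.map_wayBelow' x y h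
theorem map_isLUB (f : CuMorphism S T) {z : ℕ → S} (hz : Monotone z) {s : S}
    (h : IsLUB (Set.range z) s) : IsLUB (Set.range fun n => f (z n)) (f s) :=
  f.map_isLUB' z hz s h

/-- The identity morphism. -/
def id (S : Type u) [AddCommMonoid S] [PartialOrder S] : CuMorphism S S where
  toFun x := x
  map_zero' := rfl
  map_add' _ _ := rfl
  monotone' := monotone_id
  map_wayBelow' _ _ h := h
  map_isLUB' _ _ _ h := h

/-- Composition: `g.comp f` is `x ↦ g (f x)`. -/
def comp (g : CuMorphism T V) (f : CuMorphism S T) : CuMorphism S V where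
  toFun x := g (f x)
  map_zero' := by rw [f.map_zero, g.map_zero]
  map_add' x y := by rw [f.map_add, g.map_add]
  monotone' := g.monotone.comp f.monotone
  map_wayBelow' _ _ h := g.map_wayBelow (f.map_wayBelow h)
  map_isLUB' _ hz _ h := g.map_isLUB (f.monotone.comp hz) (f.map_isLUB hz h)

end CuMorphism

end CuStarTheory

open CuStarTheory

/-- The category `Cu` of abstract Cuntz semigroups. -/
structure CuCat : Type (u + 1) where
  carrier : Type u
  [addCommMonoid : AddCommMonoid carrier]
  [partialOrder : PartialOrder carrier]
  [isCu : IsCuSemigroup carrier]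

attribute [instance] CuCat.addCommMonoid CuCat.partialOrder CuCat.isCu

instance : CoeSort CuCat.{u} (Type u) := ⟨CuCat.carrier⟩

instance : Category CuCat.{u} where
  Hom S T := CuMorphism S T
  id S := CuMorphism.id S
  comp f g := CuMorphism.comp g f

instance : ConcreteCategory CuCat.{u} (fun S T => CuMorphism S T) where
  hom f := f
  ofHom f := f

/-- The category `Cu*`. -/
structure CuStarCat : Type (u + 1) where
  carrier : Type u
  [addCommMonoid : AddCommMonoid carrier]
  [partialOrder : PartialOrder carrier]
  [isCuStar : IsCuStarSemigroup carrier]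

attribute [instance] CuStarCat.addCommMonoid CuStarCat.partialOrder CuStarCat.isCuStar

instance : CoeSort CuStarCat.{u} (Type u) := ⟨CuStarCat.carrier⟩

instance : Category CuStarCat.{u} where
  Hom S T := CuMorphism S T
  id S := CuMorphism.id S
  comp f g := CuMorphism.comp g f

instance : ConcreteCategory CuStarCat.{u} (fun S T => CuMorphism S T) where
  hom f := f
  ofHom f := f

/-- The property of having a maximal element. -/
def CuStarCat.hasMaximal : ObjectProperty CuStarCat.{u} := fun S => ∃ m : S, IsMax m

/-- The full subcategory of `Cu*` whose objects have maximal elements. -/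
abbrev CuStarMaxCat : Type (u + 1) := CuStarCat.hasMaximal.{u}.FullSubcategory

namespace CuStarTheory

/-- The positive cone `S_+`, with the induced addition and order. -/
abbrev PosCone (S : Type u) [AddCommMonoid S] [PartialOrder S] : Type u := {x : S // 0 ≤ x}

/-- The set `S_max` of maximal elements. -/
abbrev MaxElems (S : Type u) [PartialOrder S] : Type u := {x : S // IsMax x}

section Positive

theorem PosCone.isLUB_iff {S : Type u} [AddCommMonoid S] [PartialOrder S] (z : ℕ → PosCone S) (s : PosCone S) :
    IsLUB (Set.range z) s ↔ IsLUB (Set.range fun n => (z n : S)) (s : S) := by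
  constructor
  · rintro ⟨h1, h2⟩
    refine ⟨?_, fun b hb => ?_⟩
    · rintro _ ⟨n, rfl⟩
      exact h1 ⟨n, rfl⟩
    · have hb0 : (0 : S) ≤ b := (z 0).2.trans (hb ⟨0, rfl⟩)
      have : s ≤ ⟨b, hb0⟩ := h2 (by rintro _ ⟨n, rfl⟩; exact hb ⟨n, rfl⟩)
      exact this
  · rintro ⟨h1, h2⟩
    refine ⟨?_, fun b hb => ?_⟩
    · rintro _ ⟨n, rfl⟩
      exact h1 ⟨n, rfl⟩
    · exact h2 (by rintro _ ⟨n, rfl⟩; exact hb ⟨n, rfl⟩)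

theorem isLUB_shift {S : Type u} [PartialOrder S] {z : ℕ → S} (hz : Monotone z) (k : ℕ) (s : S)
    (h : IsLUB (Set.range z) s) : IsLUB (Set.range fun n => z (n + k)) s := by
  refine ⟨?_, fun b hb => h.2 ?_⟩
  · rintro _ ⟨n, rfl⟩
    exact h.1 ⟨n + k, rfl⟩
  · rintro _ ⟨n, rfl⟩
    exact (hz (Nat.le_add_right n k)).trans (hb ⟨n, rfl⟩)

theorem WayBelow.le {S : Type u} [PartialOrder S] {x y : S} (h : WayBelow x y) : x ≤ y := by
  obtain ⟨_, hk⟩ := h (fun _ => y) monotone_const y (by simp) le_rfl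
  exact hk

variable {S T : Type u} [AddCommMonoid S] [PartialOrder S] [IsCuStarSemigroup S]
  [AddCommMonoid T] [PartialOrder T] [IsCuStarSemigroup T]

theorem PosCone.wayBelow_iff (x y : PosCone S) : WayBelow x y ↔ WayBelow (x : S) (y : S) := by
  constructor
  · intro h z hz s hs hy
    obtain ⟨k, hk⟩ := IsCuStarSemigroup.zero_compact z hz s hs (y.2.trans hy)
    have hpos : ∀ n, 0 ≤ z (n + k) := fun n => hk.trans (hz (Nat.le_add_left k n))
    obtain ⟨n, hn⟩ := h (fun n => ⟨z (n + k), hpos n⟩)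
      (fun a b hab => hz (Nat.add_le_add_right hab k)) ⟨s, y.2.trans hy⟩
      ((PosCone.isLUB_iff _ _).2 (isLUB_shift hz k s hs)) hy
    exact ⟨n + k, hn⟩
  · intro h z hz s hs hy
    obtain ⟨k, hk⟩ := h (fun n => z n) (fun a b hab => hz hab) s
      ((PosCone.isLUB_iff _ _).1 hs) hy
    exact ⟨k, hk⟩

instance PosCone.isCuSemigroup : IsCuSemigroup (PosCone S) where
  o1 z hz := by
    obtain ⟨s, hs⟩ := CuntzAxioms.o1 (fun n => (z n : S)) (fun a b hab => hz hab)
    exact ⟨⟨s, (z 0).2.trans (hs.1 ⟨0, rfl⟩)⟩, (PosCone.isLUB_iff _ _).2 hs⟩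
  o2 x := by
    obtain ⟨z, hz, hx⟩ := CuntzAxioms.o2 (x : S)
    have hm : Monotone z := monotone_nat_of_le_succ fun n => (hz n).le
    obtain ⟨k, hk⟩ := IsCuStarSemigroup.zero_compact z hm x hx x.2
    refine ⟨fun n => ⟨z (n + k), hk.trans (hm (Nat.le_add_left k n))⟩, fun n => ?_, ?_⟩
    · rw [PosCone.wayBelow_iff]
      have := hz (n + k)
      rwa [Nat.add_right_comm] at this
    · exact (PosCone.isLUB_iff _ _).2 (isLUB_shift hm k x hx)
  o3 x' x y' y hx hy := by
    rw [PosCone.wayBelow_iff] at hx hy ⊢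
    exact CuntzAxioms.o3 _ _ _ _ hx hy
  o4 x y hx hy s t hs ht := by
    rw [PosCone.isLUB_iff] at hs ht ⊢
    exact CuntzAxioms.o4 (fun n => (x n : S)) (fun n => (y n : S)) (fun a b hab => hx hab)
      (fun a b hab => hy hab) _ _ hs ht
  zero_le x := x.2

/-- The restriction `α_+ : S_+ → T_+` of `α`. -/
def CuMorphism.pos (f : CuMorphism S T) : CuMorphism (PosCone S) (PosCone T) where
  toFun x := ⟨f x, f.map_zero.symm.le.trans (f.monotone x.2)⟩
  map_zero' := Subtype.ext f.map_zero
  map_add' x y := Subtype.ext (f.map_add x y)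
  monotone' _ _ h := f.monotone h
  map_wayBelow' _ _ h :=
    (PosCone.wayBelow_iff _ _).2 (f.map_wayBelow ((PosCone.wayBelow_iff _ _).1 h))
  map_isLUB' z hz _ h := (PosCone.isLUB_iff _ _).2
    (f.map_isLUB (z := fun n => (z n : S)) (fun _ _ hab => hz hab) ((PosCone.isLUB_iff _ _).1 h))

end Positive

section Maximal

variable {S : Type u} [AddCommMonoid S] [PartialOrder S] [IsCuStarSemigroup S]

theorem exists_largest_positive (h : ∃ m : S, IsMax m) : ∃ e : S, IsGreatest (Set.Ici 0) e := by
  obtain ⟨m, hm⟩ := h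
  obtain ⟨p, hp⟩ := IsCuStarSemigroup.pd m
  refine ⟨m + p, hp, fun x hx => ?_⟩
  have hx : (0 : S) ≤ x := hx
  have h1 : m + x = m := (hm.eq_of_le (le_add_of_nonneg_right hx)).symm
  calc x ≤ (m + p) + x := le_add_of_nonneg_left hp
    _ = (m + x) + p := add_right_comm _ _ _
    _ = m + p := by rw [h1]

theorem largest_add {e x : S} (he : IsGreatest (Set.Ici 0) e) (hx : 0 ≤ x) : e + x = e :=
  le_antisymm (he.2 (add_nonneg he.1 hx)) (le_add_of_nonneg_right hx)

theorem isMax_add_largest {e : S} (he : IsGreatest (Set.Ici 0) e) (s : S) : IsMax (s + e) := by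
  intro t ht
  have he0 : (0 : S) ≤ e := he.1
  obtain ⟨p, hp⟩ := IsCuStarSemigroup.pd s
  have h1 : e ≤ t + p := by
    calc e ≤ (s + p) + e := le_add_of_nonneg_left hp
      _ = (s + e) + p := add_right_comm _ _ _
      _ ≤ t + p := by gcongr
  have h2 : t + p = e := le_antisymm (he.2 (he0.trans h1)) h1
  calc t ≤ t + e := le_add_of_nonneg_right he0
    _ = t + (e + (s + p)) := by rw [largest_add he hp]
    _ = s + e + (t + p) := by abel
    _ = s + (e + e) := by rw [h2, add_assoc]
    _ = s + e := by rw [largest_add he he0]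

theorem IsMax.add_largest {e m : S} (he : IsGreatest (Set.Ici 0) e) (hm : IsMax m) :
    m + e = m :=
  (hm.eq_of_le (le_add_of_nonneg_right he.1)).symm

theorem largest_isMax {e : S} (he : IsGreatest (Set.Ici 0) e) : IsMax e := by
  have := isMax_add_largest he 0
  rwa [zero_add] at this

theorem IsMax.add {e a b : S} (he : IsGreatest (Set.Ici 0) e) (hb : IsMax b) :
    IsMax (a + b) := by
  have := isMax_add_largest he (a + b)
  rwa [add_assoc, IsMax.add_largest he hb] at this

theorem exists_neg_max {e : S} (he : IsGreatest (Set.Ici 0) e) (m : S) :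
    ∃ n : S, IsMax n ∧ n + m = e := by
  obtain ⟨p, hp⟩ := IsCuStarSemigroup.pd m
  refine ⟨p + e, isMax_add_largest he p, ?_⟩
  calc p + e + m = e + (m + p) := by abel
    _ = e := largest_add he hp

/-- The group structure on `S_max`: the addition is that of `S` and the neutral element is the
largest element of `S_+`. -/
noncomputable abbrev maxGroup (h : ∃ m : S, IsMax m) : AddCommGroup (MaxElems S) :=
  let e := (exists_largest_positive h).choose
  have he : IsGreatest (Set.Ici 0) e := (exists_largest_positive h).choose_spec
  letI : Add (MaxElems S) := ⟨fun a b => ⟨a.1 + b.1, IsMax.add he b.2⟩⟩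
  letI : Zero (MaxElems S) := ⟨⟨e, largest_isMax he⟩⟩
  letI : Neg (MaxElems S) := ⟨fun a =>
    ⟨(exists_neg_max he a.1).choose, (exists_neg_max he a.1).choose_spec.1⟩⟩
  { add_assoc := fun a b c => Subtype.ext (add_assoc a.1 b.1 c.1)
    add_comm := fun a b => Subtype.ext (add_comm a.1 b.1)
    zero_add := fun a => Subtype.ext ((add_comm e a.1).trans (IsMax.add_largest he a.2))
    add_zero := fun a => Subtype.ext (IsMax.add_largest he a.2)
    neg_add_cancel := fun a => Subtype.ext (exists_neg_max he a.1).choose_spec.2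
    nsmul := nsmulRec
    zsmul := zsmulRec }

end Maximal

end CuStarTheory

/-- The functor `ν_+ : Cu* → Cu`, `S ↦ S_+`, `α ↦ α_+`. -/
def nuPlus : CuStarCat.{u} ⥤ CuCat.{u} where
  obj S := ⟨PosCone S⟩
  map α := CuMorphism.pos α

noncomputable instance CuStarMaxCat.maxGroup (S : CuStarMaxCat.{u}) :
    AddCommGroup (MaxElems S.obj) :=
  CuStarTheory.maxGroup S.property

namespace CuStarMaxCat

/-- The neutral element `e_{S_max}` is the largest element of `S_+`. -/
theorem zero_isGreatest (S : CuStarMaxCat.{u}) :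
    IsGreatest (Set.Ici 0) ((0 : MaxElems S.obj) : S.obj) :=
  (exists_largest_positive S.property).choose_spec

theorem coe_add (S : CuStarMaxCat.{u}) (x y : MaxElems S.obj) :
    ((x + y : MaxElems S.obj) : S.obj) = (x : S.obj) + (y : S.obj) := rfl

/-- The group morphism `α_max : S_max → T_max`, `x ↦ α x + e_{T_max}`. -/
noncomputable def maxMap {S T : CuStarMaxCat.{u}} (α : CuMorphism S.obj T.obj) :
    MaxElems S.obj →+ MaxElems T.obj where
  toFun x := ⟨α x + ((0 : MaxElems T.obj) : T.obj), isMax_add_largest T.zero_isGreatest _⟩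
  map_zero' := by
    apply Subtype.ext
    have h : (0 : T.obj) ≤ α ((0 : MaxElems S.obj) : S.obj) :=
      α.map_zero.symm.le.trans (α.monotone S.zero_isGreatest.1)
    exact (add_comm _ _).trans (largest_add T.zero_isGreatest h)
  map_add' x y := by
    apply Subtype.ext
    simp only [coe_add]
    rw [α.map_add, add_add_add_comm, largest_add T.zero_isGreatest T.zero_isGreatest.1]

end CuStarMaxCat

/-- The functor `ν_max : Cu* → AbGp` on `Cu*`-semigroups with maximal elements,
`S ↦ S_max`, `α ↦ α_max`. -/
noncomputable def nuMax : CuStarMaxCat.{u} ⥤ AddCommGrpCat.{u} where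
  obj S := AddCommGrpCat.of (MaxElems S.obj)
  map α := AddCommGrpCat.ofHom (CuStarMaxCat.maxMap α.hom)
  map_id S := by
    apply AddCommGrpCat.hom_ext
    apply AddMonoidHom.ext
    intro x
    exact Subtype.ext (IsMax.add_largest S.zero_isGreatest x.2)
  map_comp {S T V} α β := by
    apply AddCommGrpCat.hom_ext
    apply AddMonoidHom.ext
    intro x
    let a : CuMorphism S.obj T.obj := α.hom
    let b : CuMorphism T.obj V.obj := β.hom
    have h : (0 : V.obj) ≤ b ((0 : MaxElems T.obj) : T.obj) :=
      b.map_zero.symm.le.trans (b.monotone T.zero_isGreatest.1)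
    have key : b (a x) + ((0 : MaxElems V.obj) : V.obj) =
        b (a x + ((0 : MaxElems T.obj) : T.obj)) + ((0 : MaxElems V.obj) : V.obj) := by
      rw [b.map_add, add_assoc, add_comm (b ((0 : MaxElems T.obj) : T.obj)),
        largest_add V.zero_isGreatest h]
    exact Subtype.ext key

/-!
The two functors are treated by different means.

For `ν_+`, inductive limits in `Cu*` are constructed. A cocone under a directed system is a colimit
as soon as it satisfies `IsInductiveLimit`: every element of its point is the supremum of an
increasing sequence of images, and inequalities between images are, up to `≪`, visible at some
index. Indeed a compatible family `f` then extends to the point by taking suprema of values of `f`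
(`IsInductiveLimit.exists_desc`), and this needs only (O1)-(O4), so it serves in `Cu` as well as in
`Cu*`. A cocone of this kind exists: on the algebraic direct limit, `≪` induces an auxiliary
relation, and the countably generated round ideals of that relation, ordered by inclusion, form a
`Cu*`-semigroup (`RoundIdeal`, `InductiveLimit.isInductiveLimit`). Because `0 ≪ 0`, an element of
the system with positive image becomes positive at some index, so the condition passes to positive
cones (`IsInductiveLimit.pos`). As colimits are unique up to isomorphism, it is enough to know that
`ν_+` preserves this particular one.

For `ν_max` this route is closed, since the completed direct limit need not have a maximal element
even if all members of the system do. Instead an abelian group `G` is turned into the object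
`{0} ⊔ G` of `Cu*`, ordered by the single relation `0 ≤ 0_G`. A homomorphism `g : S_max → G` extends
to the morphism `S → {0} ⊔ G` with `0 ↦ 0` and `x ↦ g (x + e)` for `x ≠ 0`, and a morphism
`S → {0} ⊔ G` restricts to a homomorphism `S_max → G`. Uniqueness of homomorphisms out of the maximal
elements of a colimit follows at once. For existence, a cocone with point `G` under the groups
`S_max` has to be lifted to a cocone in `Cu*`; here the elements sent to the adjoined `0` must be
those that vanish in the limit, which means that every element way below them is sent to `0` at
some index (`Vanishes`). They form a subset that is compatible with all the structure and on which
the homomorphisms are trivial, so that `Vanishes.collapse` is a morphism.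
-/

namespace CuStarTheory

/-! ### The way-below relation -/

theorem WayBelow.trans_le {S : Type u} [PartialOrder S] {x y z : S} (h : WayBelow x y)
    (hyz : y ≤ z) : WayBelow x z :=
  fun w hw s hs hz => h w hw s hs (hyz.trans hz)

theorem WayBelow.le_trans {S : Type u} [PartialOrder S] {x y z : S} (hxy : x ≤ y)
    (h : WayBelow y z) : WayBelow x z := fun w hw s hs hz =>
  (h w hw s hs hz).imp fun _ hk => hxy.trans hk

theorem WayBelow.trans {S : Type u} [PartialOrder S] {x y z : S} (h : WayBelow x y)
    (h' : WayBelow y z) : WayBelow x z := h.trans_le h'.le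

section Approximation

variable {S : Type u} [AddCommMonoid S] [PartialOrder S] [CuntzAxioms S]

theorem exists_wayBelow_seq (x : S) : ∃ z : ℕ → S, Monotone z ∧
    (∀ n, WayBelow (z n) (z (n + 1))) ∧ (∀ n, WayBelow (z n) x) ∧ IsLUB (Set.range z) x := by
  obtain ⟨z, hz, hx⟩ := CuntzAxioms.o2 x
  exact ⟨z, monotone_nat_of_le_succ fun n => (hz n).le, hz,
    fun n => (hz n).trans_le (hx.1 ⟨n + 1, rfl⟩), hx⟩

theorem WayBelow.exists_between {x y : S} (h : WayBelow x y) :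
    ∃ z, WayBelow x z ∧ WayBelow z y := by
  obtain ⟨z, hm, hz, hzy, hy⟩ := exists_wayBelow_seq y
  obtain ⟨n, hn⟩ := h z hm y hy le_rfl
  exact ⟨z (n + 1), WayBelow.le_trans hn (hz n), hzy _⟩

/-- Unlike in the definition of `≪`, the term of the sequence is way above `x`. -/
theorem WayBelow.exists_wayBelow_of_isLUB {x y : S} (h : WayBelow x y) {z : ℕ → S}
    (hz : Monotone z) (hy : IsLUB (Set.range z) y) : ∃ n, WayBelow x (z n) := by
  obtain ⟨w, hxw, hwy⟩ := h.exists_between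
  obtain ⟨n, hn⟩ := hwy z hz y hy le_rfl
  exact ⟨n, hxw.trans_le hn⟩

theorem WayBelow.exists_add [IsOrderedAddMonoid S] {x a b : S} (h : WayBelow x (a + b)) :
    ∃ a' b', WayBelow a' a ∧ WayBelow b' b ∧ WayBelow x (a' + b') := by
  obtain ⟨z, hm, -, hza, ha⟩ := exists_wayBelow_seq a
  obtain ⟨w, hm', -, hwb, hb⟩ := exists_wayBelow_seq b
  obtain ⟨n, hn⟩ := h.exists_wayBelow_of_isLUB (fun i j hij => add_le_add (hm hij) (hm' hij))
    (CuntzAxioms.o4 z w hm hm' a b ha hb)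
  exact ⟨z n, w n, hza n, hwb n, hn⟩

end Approximation

/-! ### Recognizing inductive limits -/

section InductiveLimit

variable {I : Type u} [Preorder I] {X : I → Type u}
  [∀ i, AddCommMonoid (X i)] [∀ i, PartialOrder (X i)]
  {C : Type u} [AddCommMonoid C] [PartialOrder C]
  {D : Type u} [AddCommMonoid D] [PartialOrder D]

/-- An intrinsic description of the inductive limit of a directed system of `CuMorphism`s `t`:
every element of `C` is the supremum of an increasing sequence of images of elements of the
system, and an inequality between images is already visible at some index of the system, once the
smaller element has been replaced by one way below it. -/
structure IsInductiveLimit (t : ∀ i j, i ≤ j → CuMorphism (X i) (X j))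
    (c : ∀ i, CuMorphism (X i) C) : Prop where
  compat : ∀ i j (h : i ≤ j) x, c j (t i j h x) = c i x
  dense : ∀ x : C, ∃ p : ℕ → Σ i, X i, (Monotone fun n => c (p n).1 (p n).2) ∧
    IsLUB (Set.range fun n => c (p n).1 (p n).2) x
  reflects : ∀ i j (x' x : X i) (y : X j), WayBelow x' x → c i x ≤ c j y →
    ∃ k, ∃ (hi : i ≤ k) (hj : j ≤ k), t i k hi x' ≤ t j k hj y

namespace IsInductiveLimit

variable {t : ∀ i j, i ≤ j → CuMorphism (X i) (X j)} {c : ∀ i, CuMorphism (X i) C}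

theorem hom_ext (hc : IsInductiveLimit t c) {g g' : CuMorphism C D}
    (h : ∀ i x, g (c i x) = g' (c i x)) : g = g' := by
  ext x
  obtain ⟨p, hp, hx⟩ := hc.dense x
  have h1 := g.map_isLUB hp hx
  have h2 := g'.map_isLUB hp hx
  simp only [h] at h1
  exact h1.unique h2

variable [∀ i, CuntzAxioms (X i)] {f : ∀ i, CuMorphism (X i) D}

theorem le_of_le (hc : IsInductiveLimit t c) (hf : ∀ i j (h : i ≤ j) x, f j (t i j h x) = f i x)
    {i j : I} {x : X i} {y : X j} (h : c i x ≤ c j y) : f i x ≤ f j y := by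
  obtain ⟨z, hm, -, hzx, hx⟩ := exists_wayBelow_seq x
  refine ((f i).map_isLUB hm hx).2 ?_
  rintro _ ⟨n, rfl⟩
  obtain ⟨k, hi, hj, hk⟩ := hc.reflects i j (z n) x y (hzx n) h
  have := (f k).monotone hk
  rwa [hf, hf] at this

/-- The upper bounds of the images of a sequence exhausting `x : C` bound the images of all
elements of the system lying below `x`; this makes the induced map on `C` independent of the
exhausting sequence. -/
theorem le_of_isLUB (hc : IsInductiveLimit t c)
    (hf : ∀ i j (h : i ≤ j) x, f j (t i j h x) = f i x)
    {p : ℕ → Σ i, X i} (hp : Monotone fun n => c (p n).1 (p n).2) {x : C}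
    (hx : IsLUB (Set.range fun n => c (p n).1 (p n).2) x) {b : D}
    (hb : ∀ n, f (p n).1 (p n).2 ≤ b) {i : I} {y : X i} (hy : c i y ≤ x) : f i y ≤ b := by
  obtain ⟨z, hm, -, hzy, hzl⟩ := exists_wayBelow_seq y
  refine ((f i).map_isLUB hm hzl).2 ?_
  rintro _ ⟨n, rfl⟩
  obtain ⟨k, hk⟩ := (c i).map_wayBelow (hzy n) _ hp x hx hy
  exact (hc.le_of_le hf hk).trans (hb k)

theorem exists_isLUB [CuntzAxioms D] (hc : IsInductiveLimit t c)
    (hf : ∀ i j (h : i ≤ j) x, f j (t i j h x) = f i x) (x : C) :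
    ∃ d : D, IsLUB {b | ∃ i y, c i y ≤ x ∧ f i y = b} d := by
  obtain ⟨p, hp, hx⟩ := hc.dense x
  obtain ⟨d, hd⟩ := CuntzAxioms.o1 (fun n => f (p n).1 (p n).2)
    (fun m n hmn => hc.le_of_le hf (hp hmn))
  refine ⟨d, ?_, fun b hb => hd.2 ?_⟩
  · rintro _ ⟨i, y, hy, rfl⟩
    exact hc.le_of_isLUB hf hp hx (fun n => hd.1 ⟨n, rfl⟩) hy
  · rintro _ ⟨n, rfl⟩
    exact hb ⟨_, _, hx.1 ⟨n, rfl⟩, rfl⟩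

variable [IsDirectedOrder I] [Nonempty I] [CuntzAxioms C] [IsOrderedAddMonoid C]
  [CuntzAxioms D]

/-- The universal property of an inductive limit: a compatible family `f` of morphisms out of the
system extends to `C` by sending `x` to the supremum of the values of `f` on the elements of the
system whose image lies below `x`. -/
theorem exists_desc (hc : IsInductiveLimit t c)
    (hf : ∀ i j (h : i ≤ j) x, f j (t i j h x) = f i x) :
    ∃ g : CuMorphism C D, ∀ i x, g (c i x) = f i x := by
  choose g hg using hc.exists_isLUB hf
  have hgc : ∀ i x, g (c i x) = f i x := fun i x => le_antisymm
    ((hg _).2 (by rintro _ ⟨j, y, hy, rfl⟩; exact hc.le_of_le hf hy)) ((hg _).1 ⟨i, x, le_rfl, rfl⟩)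
  have hgm : Monotone g := fun x y hxy => (hg x).2 (by
    rintro _ ⟨i, z, hz, rfl⟩
    exact (hg y).1 ⟨i, z, hz.trans hxy, rfl⟩)
  have hseq : ∀ {p : ℕ → Σ i, X i} {x : C}, (Monotone fun n => c (p n).1 (p n).2) →
      IsLUB (Set.range fun n => c (p n).1 (p n).2) x →
      IsLUB (Set.range fun n => f (p n).1 (p n).2) (g x) := by
    intro p x hp hx
    refine ⟨?_, fun b hb => (hg x).2 ?_⟩
    · rintro _ ⟨n, rfl⟩
      exact (hg x).1 ⟨_, _, hx.1 ⟨n, rfl⟩, rfl⟩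
    · rintro _ ⟨i, y, hy, rfl⟩
      exact hc.le_of_isLUB hf hp hx (fun n => hb ⟨n, rfl⟩) hy
  refine ⟨⟨⟨⟨⟨g, ?_⟩, ?_⟩, hgm⟩, ?_, ?_⟩, hgc⟩
  · obtain ⟨i⟩ := ‹Nonempty I›
    rw [← (c i).map_zero, hgc, (f i).map_zero]
  · intro x y
    obtain ⟨p, hp, hx⟩ := hc.dense x
    obtain ⟨q, hq, hy⟩ := hc.dense y
    -- the sum of two elements of the system, formed at a common index
    have hr : ∀ n, ∃ r : Σ i, X i,
        c r.1 r.2 = c (p n).1 (p n).2 + c (q n).1 (q n).2 ∧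
        f r.1 r.2 = f (p n).1 (p n).2 + f (q n).1 (q n).2 := fun n => by
      obtain ⟨k, h1, h2⟩ := exists_ge_ge (p n).1 (q n).1
      exact ⟨⟨k, t _ _ h1 (p n).2 + t _ _ h2 (q n).2⟩,
        by rw [(c k).map_add, hc.compat, hc.compat], by rw [(f k).map_add, hf, hf]⟩
    choose r hrc hrf using hr
    have h := hseq (p := r) (x := x + y)
    simp only [hrc, hrf] at h
    refine (h (fun m n hmn => add_le_add (hp hmn) (hq hmn))
      (CuntzAxioms.o4 _ _ hp hq _ _ hx hy)).unique ?_
    exact CuntzAxioms.o4 _ _ (fun m n hmn => hc.le_of_le hf (hp hmn))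
      (fun m n hmn => hc.le_of_le hf (hq hmn)) _ _ (hseq hp hx) (hseq hq hy)
  · intro x y hxy
    obtain ⟨p, hp, hy⟩ := hc.dense y
    obtain ⟨n, hn⟩ := hxy.exists_wayBelow_of_isLUB hp hy
    obtain ⟨z, hm, -, hzp, hz⟩ := exists_wayBelow_seq (p n).2
    obtain ⟨k, hk⟩ := hn _ ((c _).monotone.comp hm) _ ((c _).map_isLUB hm hz) le_rfl
    refine WayBelow.le_trans (hgm hk) (WayBelow.trans_le ?_ (hgm (hy.1 ⟨n, rfl⟩)))
    simp only [Function.comp_apply, hgc]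
    exact (f _).map_wayBelow (hzp k)
  · intro z hz s hs
    refine ⟨?_, fun b hb => (hg s).2 ?_⟩
    · rintro _ ⟨n, rfl⟩
      exact hgm (hs.1 ⟨n, rfl⟩)
    · rintro _ ⟨i, y, hy, rfl⟩
      obtain ⟨w, hm, -, hwy, hw⟩ := exists_wayBelow_seq y
      refine ((f i).map_isLUB hm hw).2 ?_
      rintro _ ⟨m, rfl⟩
      obtain ⟨n, hn⟩ := (c i).map_wayBelow (hwy m) z hz s hs hy
      have := (hgm hn).trans (hb ⟨n, rfl⟩)
      rwa [hgc] at this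

end IsInductiveLimit

end InductiveLimit

/-! ### Completion of a monoid with an auxiliary relation -/

/-- The conditions on a transitive relation `r` on a commutative monoid under which the countably
generated round ideals of `r` form a `Cu*`-semigroup. Here `r` plays the role of `≪`, and no order
is given; `pc`, `pd` and `s0` are the traces of the axioms (PC), (PD) and (S0). -/
class IsPreCuStar {A : Type u} [AddCommMonoid A] (r : A → A → Prop) : Prop where
  trans : ∀ {a b c}, r a b → r b c → r a c
  exists_seq : ∀ a, ∃ z : ℕ → A, (∀ n, r (z n) (z (n + 1))) ∧ (∀ n, r (z n) a) ∧
    ∀ x, r x a → ∃ n, r x (z n)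
  add : ∀ {a b a' b'}, r a b → r a' b' → r (a + a') (b + b')
  exists_add : ∀ {x a b}, r x (a + b) → ∃ a' b', r a' a ∧ r b' b ∧ r x (a' + b')
  zero : r 0 0
  pc : ∀ {a b}, r a b → r 0 b → r 0 (a + b)
  pd : ∀ a, ∃ p, r 0 (a + p)
  s0 : ∀ {a b}, r (a + b) 0 → a = 0 ∧ b = 0

/-- The countably generated round ideals of a relation `r`: the sets that are downward closed and
upward directed for `r` and have a countable cofinal subset (so they are nonempty). -/
@[ext] structure RoundIdeal {A : Type u} (r : A → A → Prop) : Type u where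
  carrier : Set A
  directed : ∀ x ∈ carrier, ∀ y ∈ carrier, ∃ z ∈ carrier, r x z ∧ r y z
  lower : ∀ x y, r x y → y ∈ carrier → x ∈ carrier
  cofinal : ∃ u : ℕ → A, (∀ n, u n ∈ carrier) ∧ ∀ x ∈ carrier, ∃ n, r x (u n)

namespace RoundIdeal

variable {A : Type u} {r : A → A → Prop}

instance : SetLike (RoundIdeal r) A where
  coe := carrier
  coe_injective _ _ h := RoundIdeal.ext h

instance : PartialOrder (RoundIdeal r) := PartialOrder.lift carrier fun _ _ h => RoundIdeal.ext h

theorem le_def {J K : RoundIdeal r} : J ≤ K ↔ ∀ x ∈ J, x ∈ K := Iff.rfl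

theorem exists_gt {J : RoundIdeal r} {x : A} (hx : x ∈ J) : ∃ y ∈ J, r x y := by
  obtain ⟨z, hz, h, -⟩ := J.directed x hx x hx
  exact ⟨z, hz, h⟩

/-- The union of an increasing sequence of round ideals. -/
def union (z : ℕ → RoundIdeal r) (hz : Monotone z) : RoundIdeal r where
  carrier := {a | ∃ n, a ∈ z n}
  directed := by
    rintro x ⟨m, hm⟩ y ⟨n, hn⟩
    obtain ⟨w, hw, h⟩ := (z (max m n)).directed x (hz (le_max_left m n) hm)
      y (hz (le_max_right m n) hn)
    exact ⟨w, ⟨_, hw⟩, h⟩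
  lower := fun x y h ⟨n, hn⟩ => ⟨n, (z n).lower x y h hn⟩
  cofinal := by
    choose u hu hu' using fun n => (z n).cofinal
    refine ⟨fun k => u k.unpair.1 k.unpair.2, fun k => ⟨_, hu _ _⟩, ?_⟩
    rintro x ⟨n, hn⟩
    obtain ⟨m, hm⟩ := hu' n x hn
    exact ⟨Nat.pair n m, by simpa using hm⟩

theorem isLUB_union (z : ℕ → RoundIdeal r) (hz : Monotone z) :
    IsLUB (Set.range z) (union z hz) := by
  refine ⟨?_, ?_⟩
  · rintro _ ⟨n, rfl⟩ a ha
    exact ⟨n, ha⟩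
  · rintro K hK a ⟨n, hn⟩
    exact hK ⟨n, rfl⟩ hn

theorem isLUB_iff {z : ℕ → RoundIdeal r} (hz : Monotone z) {J : RoundIdeal r} :
    IsLUB (Set.range z) J ↔ ∀ a, a ∈ J ↔ ∃ n, a ∈ z n := by
  constructor
  · intro h a
    rw [h.unique (isLUB_union z hz)]
    exact Iff.rfl
  · intro h
    have : J = union z hz := RoundIdeal.ext (Set.ext h)
    exact this ▸ isLUB_union z hz

variable [AddCommMonoid A] [IsPreCuStar r]

theorem exists_chain (J : RoundIdeal r) : ∃ w : ℕ → A, (∀ n, w n ∈ J) ∧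
    (∀ m n, m < n → r (w m) (w n)) ∧ ∀ x ∈ J, ∃ n, r x (w n) := by
  obtain ⟨u, hu, hu'⟩ := J.cofinal
  have hstep : ∀ (x : {x // x ∈ J}) (n : ℕ), ∃ y : {x // x ∈ J}, r x.1 y.1 ∧ r (u n) y.1 := by
    intro x n
    obtain ⟨y, hy, h⟩ := J.directed x.1 x.2 (u n) (hu n)
    exact ⟨⟨y, hy⟩, h⟩
  choose next hn hn' using hstep
  let w : ℕ → {x // x ∈ J} := fun n => Nat.rec ⟨u 0, hu 0⟩ (fun n x => next x n) n
  have : IsTrans A r := ⟨fun _ _ _ => IsPreCuStar.trans⟩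
  refine ⟨fun n => (w n).1, fun n => (w n).2, fun m n hmn =>
    Nat.rel_of_forall_rel_succ_of_lt r (f := fun n => (w n).1) (fun n => hn (w n) n) hmn, ?_⟩
  intro x hx
  obtain ⟨n, h⟩ := hu' x hx
  exact ⟨n + 1, IsPreCuStar.trans h (hn' (w n) n)⟩

/-- The principal round ideal `{x | r x a}`. -/
def principal (r : A → A → Prop) [IsPreCuStar r] (a : A) : RoundIdeal r where
  carrier := {x | r x a}
  directed := by
    obtain ⟨z, hz, hza, h⟩ := IsPreCuStar.exists_seq (r := r) a
    have : IsTrans A r := ⟨fun _ _ _ => IsPreCuStar.trans⟩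
    intro x hx y hy
    obtain ⟨m, hm⟩ := h x hx
    obtain ⟨n, hn⟩ := h y hy
    refine ⟨z (max m n + 1), hza _, IsPreCuStar.trans hm ?_, IsPreCuStar.trans hn ?_⟩ <;>
      exact Nat.rel_of_forall_rel_succ_of_lt r hz (by omega)
  lower _ _ h h' := IsPreCuStar.trans h h'
  cofinal := by
    obtain ⟨z, -, hza, h⟩ := IsPreCuStar.exists_seq (r := r) a
    exact ⟨z, hza, h⟩

@[simp] theorem mem_principal {x a : A} : x ∈ principal r a ↔ r x a := Iff.rfl

theorem principal_le {J : RoundIdeal r} {a : A} (ha : a ∈ J) : principal r a ≤ J :=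
  fun x hx => J.lower x a hx ha

instance : Add (RoundIdeal r) where
  add J K :=
    { carrier := {x | ∃ a ∈ J, ∃ b ∈ K, r x (a + b)}
      directed := by
        rintro x ⟨a, ha, b, hb, hx⟩ y ⟨a', ha', b', hb', hy⟩
        obtain ⟨c, hc, h1, h2⟩ := J.directed a ha a' ha'
        obtain ⟨d, hd, h3, h4⟩ := K.directed b hb b' hb'
        obtain ⟨c', hc', h5⟩ := exists_gt (J := J) hc
        obtain ⟨d', hd', h6⟩ := exists_gt (J := K) hd
        exact ⟨c + d, ⟨c', hc', d', hd', IsPreCuStar.add h5 h6⟩,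
          IsPreCuStar.trans hx (IsPreCuStar.add h1 h3),
          IsPreCuStar.trans hy (IsPreCuStar.add h2 h4)⟩
      lower := by
        rintro x y h ⟨a, ha, b, hb, hy⟩
        exact ⟨a, ha, b, hb, IsPreCuStar.trans h hy⟩
      cofinal := by
        obtain ⟨u, hu, hum, hu'⟩ := J.exists_chain
        obtain ⟨v, hv, hvm, hv'⟩ := K.exists_chain
        refine ⟨fun n => u n + v n, fun n => ⟨u (n + 1), hu _, v (n + 1), hv _,
          IsPreCuStar.add (hum _ _ n.lt_succ_self) (hvm _ _ n.lt_succ_self)⟩, ?_⟩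
        rintro x ⟨a, ha, b, hb, hx⟩
        obtain ⟨m, hm⟩ := hu' a ha
        obtain ⟨n, hn⟩ := hv' b hb
        exact ⟨max m n + 1, IsPreCuStar.trans hx (IsPreCuStar.add
          (IsPreCuStar.trans hm (hum _ _ (by omega)))
          (IsPreCuStar.trans hn (hvm _ _ (by omega))))⟩ }

theorem add_mem_add {J K : RoundIdeal r} {a b : A} (ha : a ∈ J) (hb : b ∈ K) : a + b ∈ J + K := by
  obtain ⟨a', ha', h⟩ := exists_gt ha
  obtain ⟨b', hb', h'⟩ := exists_gt hb
  exact ⟨a', ha', b', hb', IsPreCuStar.add h h'⟩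

theorem add_le_iff {J K L : RoundIdeal r} : J + K ≤ L ↔ ∀ a ∈ J, ∀ b ∈ K, a + b ∈ L := by
  constructor
  · exact fun h a ha b hb => h (add_mem_add ha hb)
  · rintro h x ⟨a, ha, b, hb, hx⟩
    exact L.lower _ _ hx (h a ha b hb)

theorem principal_add (a b : A) : principal r (a + b) = principal r a + principal r b := by
  apply le_antisymm
  · intro x hx
    obtain ⟨a', b', ha, hb, h⟩ := IsPreCuStar.exists_add hx
    exact ⟨a', ha, b', hb, h⟩
  · exact add_le_iff.2 fun x hx y hy => IsPreCuStar.add hx hy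

theorem add_comm' (J K : RoundIdeal r) : J + K = K + J :=
  le_antisymm (add_le_iff.2 fun a ha b hb => add_comm b a ▸ add_mem_add hb ha)
    (add_le_iff.2 fun a ha b hb => add_comm b a ▸ add_mem_add hb ha)

theorem add_assoc_le (J K L : RoundIdeal r) : J + K + L ≤ J + (K + L) := by
  rw [add_le_iff]
  rintro x ⟨a, ha, b, hb, hx⟩ c hc
  obtain ⟨c', hc', h⟩ := exists_gt hc
  refine lower _ _ _ (IsPreCuStar.add hx h) ?_
  rw [add_assoc]
  exact add_mem_add ha (add_mem_add hb hc')

theorem add_principal_zero (J : RoundIdeal r) : J + principal r 0 = J := by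
  apply le_antisymm
  · rintro x ⟨a, ha, b, hb, hx⟩
    obtain ⟨a', ha', h⟩ := exists_gt ha
    have := IsPreCuStar.add h hb
    rw [add_zero] at this
    exact J.lower _ _ (IsPreCuStar.trans hx this) ha'
  · intro x hx
    rw [← add_zero x]
    exact add_mem_add hx IsPreCuStar.zero

instance : Zero (RoundIdeal r) := ⟨principal r 0⟩

instance : AddCommMonoid (RoundIdeal r) where
  add_assoc J K L := le_antisymm (add_assoc_le J K L) (by
    rw [add_comm' J (K + L), add_comm' K L, add_comm' (J + K) L, add_comm' J K]
    exact add_assoc_le L K J)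
  zero_add J := (add_comm' _ _).trans (add_principal_zero J)
  add_zero J := add_principal_zero J
  add_comm := add_comm'
  nsmul := nsmulRec

theorem nonneg_iff {J : RoundIdeal r} : 0 ≤ J ↔ 0 ∈ J :=
  ⟨fun h => h IsPreCuStar.zero, fun h => principal_le h⟩

instance : IsOrderedAddMonoid (RoundIdeal r) where
  add_le_add_left J K h L := by
    rw [add_le_iff]
    exact fun a ha b hb => add_mem_add (h ha) hb

theorem principal_mono {a b : A} (h : r a b) : principal r a ≤ principal r b := principal_le h

/-- Every round ideal is the supremum of the principal ideals of a chain. -/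
theorem exists_principal_seq (J : RoundIdeal r) : ∃ w : ℕ → A, (∀ n, w n ∈ J) ∧
    (∀ m n, m < n → r (w m) (w n)) ∧ (Monotone fun n => principal r (w n)) ∧
    IsLUB (Set.range fun n => principal r (w n)) J := by
  obtain ⟨w, hw, hwm, h⟩ := J.exists_chain
  have hm : Monotone fun n => principal r (w n) :=
    monotone_nat_of_le_succ fun n => principal_mono (hwm _ _ n.lt_succ_self)
  refine ⟨w, hw, hwm, hm, (isLUB_iff hm).2 fun a => ⟨fun ha => h a ha, fun ⟨n, hn⟩ => ?_⟩⟩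
  exact J.lower _ _ hn (hw n)

theorem wayBelow_iff {J K : RoundIdeal r} : WayBelow J K ↔ ∃ a ∈ K, J ≤ principal r a := by
  constructor
  · intro h
    obtain ⟨w, hw, -, hm, hK⟩ := K.exists_principal_seq
    obtain ⟨n, hn⟩ := h _ hm K hK le_rfl
    exact ⟨w n, hw n, hn⟩
  · rintro ⟨a, ha, hJ⟩ z hz L hL hKL
    obtain ⟨n, hn⟩ := ((isLUB_iff hz).1 hL a).1 (hKL ha)
    exact ⟨n, hJ.trans (principal_le hn)⟩

theorem eq_zero_of_forall_mem {J : RoundIdeal r} (h : ∀ a ∈ J, a = 0) : J = 0 := by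
  obtain ⟨u, hu, -⟩ := J.cofinal
  refine le_antisymm (fun a ha => h a ha ▸ IsPreCuStar.zero) (nonneg_iff.2 ?_)
  exact h _ (hu 0) ▸ hu 0

instance : IsCuStarSemigroup (RoundIdeal r) where
  o1 z hz := ⟨_, isLUB_union z hz⟩
  o2 J := by
    obtain ⟨w, hw, hwm, hm, hJ⟩ := J.exists_principal_seq
    exact ⟨_, fun n => wayBelow_iff.2 ⟨w n, hwm _ _ n.lt_succ_self, le_rfl⟩, hJ⟩
  o3 J' J K' K hJ hK := by
    rw [wayBelow_iff] at hJ hK ⊢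
    obtain ⟨a, ha, h⟩ := hJ
    obtain ⟨b, hb, h'⟩ := hK
    exact ⟨a + b, add_mem_add ha hb, principal_add (r := r) a b ▸ add_le_add h h'⟩
  o4 x y hx hy s t hs ht := by
    rw [isLUB_iff hx] at hs
    rw [isLUB_iff hy] at ht
    rw [isLUB_iff fun m n h => add_le_add (hx h) (hy h)]
    refine fun c => ⟨?_, ?_⟩
    · rintro ⟨a, ha, b, hb, hc⟩
      obtain ⟨m, hm⟩ := (hs a).1 ha
      obtain ⟨n, hn⟩ := (ht b).1 hb
      exact ⟨max m n, a, hx (le_max_left m n) hm, b, hy (le_max_right m n) hn, hc⟩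
    · rintro ⟨n, a, ha, b, hb, hc⟩
      exact ⟨a, (hs a).2 ⟨n, ha⟩, b, (ht b).2 ⟨n, hb⟩, hc⟩
  zero_compact := wayBelow_iff.2 ⟨0, IsPreCuStar.zero, le_rfl⟩
  pc J K hK hJK := by
    rw [nonneg_iff] at hK ⊢
    obtain ⟨u, hu, -⟩ := J.cofinal
    obtain ⟨b, hb, h, h'⟩ := K.directed _ (hJK (hu 0)) _ hK
    exact (J + K).lower _ _ (IsPreCuStar.pc h h') (add_mem_add (hu 0) hb)
  pd J := by
    obtain ⟨u, hu, -⟩ := J.cofinal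
    obtain ⟨p, hp⟩ := IsPreCuStar.pd (r := r) (u 0)
    obtain ⟨a', p', ha, hp', h⟩ := IsPreCuStar.exists_add hp
    exact ⟨principal r p, nonneg_iff.2 ⟨a', J.lower _ _ ha (hu 0), p', hp', h⟩⟩
  s0 J K h := by
    have hz : ∀ a ∈ J, ∀ b ∈ K, a = 0 ∧ b = 0 := fun a ha b hb =>
      IsPreCuStar.s0 (r := r) (h.le (add_mem_add ha hb))
    obtain ⟨u, hu, -⟩ := J.cofinal
    obtain ⟨v, hv, -⟩ := K.cofinal
    exact ⟨eq_zero_of_forall_mem fun a ha => (hz a ha _ (hv 0)).1,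
      eq_zero_of_forall_mem fun b hb => (hz _ (hu 0) b hb).2⟩

end RoundIdeal

/-! ### Inductive limits of directed systems in `Cu*` -/

instance {S T : Type u} [AddCommMonoid S] [PartialOrder S] [AddCommMonoid T] [PartialOrder T] :
    AddMonoidHomClass (CuMorphism S T) S T where
  map_add := CuMorphism.map_add
  map_zero := CuMorphism.map_zero

/-- By (PC) with `t = 0`, no element other than `0` lies below `0`. -/
theorem eq_zero_of_le_zero {S : Type u} [AddCommMonoid S] [PartialOrder S]
    [IsCuStarSemigroup S] {x : S} (h : x ≤ 0) : x = 0 :=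
  le_antisymm h (add_zero x ▸ IsCuStarSemigroup.pc x 0 le_rfl h)

section Limit

variable {I : Type u} [Preorder I] [IsDirectedOrder I] {X : I → Type u}
  [∀ i, AddCommMonoid (X i)] [∀ i, PartialOrder (X i)]
  (t : ∀ i j, i ≤ j → CuMorphism (X i) (X j)) [DirectedSystem X (t · · ·)]

/-- The relation on the algebraic direct limit induced by the way-below relations: `a` and `b`
have representatives at a common index, the first way below the second. -/
def LimitBelow (a b : DirectLimit X t) : Prop :=
  ∃ i, ∃ x y : X i, WayBelow x y ∧ a = ⟦⟨i, x⟩⟧ ∧ b = ⟦⟨i, y⟩⟧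

variable {t}

theorem LimitBelow.mk {i : I} {x y : X i} (h : WayBelow x y) :
    LimitBelow t ⟦⟨i, x⟩⟧ ⟦⟨i, y⟩⟧ := ⟨i, x, y, h, rfl, rfl⟩

/-- A representative of the larger element may be chosen in advance. -/
theorem LimitBelow.exists_rep {a : DirectLimit X t} {i : I} {y : X i}
    (h : LimitBelow t a ⟦⟨i, y⟩⟧) :
    ∃ j, ∃ hj : i ≤ j, ∃ x : X j, a = ⟦⟨j, x⟩⟧ ∧ WayBelow x (t i j hj y) := by
  obtain ⟨k, x, z, hxz, rfl, hyz⟩ := h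
  obtain ⟨j, hi, hk, hj⟩ := Quotient.eq.1 hyz
  refine ⟨j, hi, t k j hk x, DirectLimit.eq_of_le ⟨k, x⟩ j hk, ?_⟩
  exact ((t k j hk).map_wayBelow hxz).trans_le hj.ge

theorem LimitBelow.exists_of_mk_mk {i j : I} {x : X i} {y : X j}
    (h : LimitBelow t ⟦⟨i, x⟩⟧ ⟦⟨j, y⟩⟧) :
    ∃ k, ∃ (hi : i ≤ k) (hj : j ≤ k), WayBelow (t i k hi x) (t j k hj y) := by
  obtain ⟨l, hl, x', hx, h⟩ := h.exists_rep
  obtain ⟨k, hi, hk, hx⟩ := Quotient.eq.1 hx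
  refine ⟨k, hi, hl.trans hk, ?_⟩
  have := (t l k hk).map_wayBelow h
  rw [DirectedSystem.map_map' t] at this
  exact WayBelow.le_trans hx.le this

variable [Nonempty I] [∀ i, IsCuStarSemigroup (X i)]

instance : IsPreCuStar (LimitBelow t) where
  trans {a b c} hab hbc := by
    obtain ⟨i, y, z, hyz, rfl, rfl⟩ := hbc
    obtain ⟨j, hj, x, rfl, hx⟩ := hab.exists_rep
    rw [DirectLimit.eq_of_le ⟨i, z⟩ j hj]
    exact .mk (hx.trans ((t i j hj).map_wayBelow hyz))
  exists_seq a := by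
    induction a using DirectLimit.induction with | ih i y => ?_
    obtain ⟨z, hm, hz, hzy, hy⟩ := exists_wayBelow_seq y
    refine ⟨fun n => ⟦⟨i, z n⟩⟧, fun n => .mk (hz n), fun n => .mk (hzy n), fun a ha => ?_⟩
    obtain ⟨j, hj, x, rfl, hx⟩ := ha.exists_rep
    obtain ⟨n, hn⟩ := hx.exists_wayBelow_of_isLUB ((t i j hj).monotone.comp hm)
      ((t i j hj).map_isLUB hm hy)
    refine ⟨n, ?_⟩
    beta_reduce
    rw [DirectLimit.eq_of_le ⟨i, z n⟩ j hj]
    exact .mk hn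
  add {a b a' b'} h h' := by
    obtain ⟨i, x, y, hxy, rfl, rfl⟩ := h
    obtain ⟨j, x', y', hxy', rfl, rfl⟩ := h'
    obtain ⟨k, hi, hj⟩ := exists_ge_ge i j
    rw [DirectLimit.eq_of_le ⟨i, x⟩ k hi, DirectLimit.eq_of_le ⟨i, y⟩ k hi,
      DirectLimit.eq_of_le ⟨j, x'⟩ k hj, DirectLimit.eq_of_le ⟨j, y'⟩ k hj,
      DirectLimit.add_def, DirectLimit.add_def]
    exact .mk (CuntzAxioms.o3 _ _ _ _ ((t i k hi).map_wayBelow hxy)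
      ((t j k hj).map_wayBelow hxy'))
  exists_add {x a b} h := by
    induction a, b using DirectLimit.induction₂ with | ih i a b => ?_
    rw [DirectLimit.add_def] at h
    obtain ⟨j, hj, x, rfl, hx⟩ := h.exists_rep
    rw [(t i j hj).map_add] at hx
    obtain ⟨a', b', ha, hb, hx⟩ := hx.exists_add
    refine ⟨⟦⟨j, a'⟩⟧, ⟦⟨j, b'⟩⟧, ?_, ?_, ?_⟩
    · rw [DirectLimit.eq_of_le ⟨i, a⟩ j hj]
      exact .mk ha
    · rw [DirectLimit.eq_of_le ⟨i, b⟩ j hj]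
      exact .mk hb
    · rw [DirectLimit.add_def]
      exact .mk hx
  zero := by
    obtain ⟨i⟩ := ‹Nonempty I›
    rw [DirectLimit.zero_def i]
    exact .mk IsCuStarSemigroup.zero_compact
  pc {a b} hab hb := by
    obtain ⟨i, x, y, hxy, rfl, rfl⟩ := hab
    rw [DirectLimit.zero_def i] at hb ⊢
    obtain ⟨j, hj, hj', h⟩ := hb.exists_of_mk_mk
    rw [(t i j hj).map_zero] at h
    rw [DirectLimit.add_def, DirectLimit.eq_of_le ⟨i, 0⟩ j hj,
      DirectLimit.eq_of_le ⟨i, x + y⟩ j hj, (t i j hj).map_zero, (t i j hj).map_add]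
    exact .mk (IsCuStarSemigroup.zero_compact.trans_le
      (IsCuStarSemigroup.pc _ _ h.le ((t i j hj).monotone hxy.le)))
  pd a := by
    induction a using DirectLimit.induction with | ih i x => ?_
    obtain ⟨p, hp⟩ := IsCuStarSemigroup.pd x
    refine ⟨⟦⟨i, p⟩⟧, ?_⟩
    rw [DirectLimit.zero_def i, DirectLimit.add_def]
    exact .mk (IsCuStarSemigroup.zero_compact.trans_le hp)
  s0 {a b} h := by
    induction a, b using DirectLimit.induction₂ with | ih i a b => ?_
    rw [DirectLimit.zero_def i, DirectLimit.add_def] at h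
    obtain ⟨j, hj, hj', h⟩ := h.exists_of_mk_mk
    rw [(t i j hj).map_zero] at h
    have h0 := eq_zero_of_le_zero h.le
    rw [(t i j hj).map_add] at h0
    obtain ⟨ha, hb⟩ := IsCuStarSemigroup.s0 _ _ h0
    rw [DirectLimit.eq_of_le ⟨i, a⟩ j hj, DirectLimit.eq_of_le ⟨i, b⟩ j hj]
    simp only [ha, hb]
    exact ⟨(DirectLimit.zero_def j).symm, (DirectLimit.zero_def j).symm⟩

variable (t)

/-- The inductive limit in `Cu*` of the directed system `t`: the completion of the algebraic direct
limit. -/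
abbrev InductiveLimit : Type u := RoundIdeal (LimitBelow t)

variable {t} in
theorem principal_mono_of_le {i : I} {x y : X i} (hxy : x ≤ y) :
    RoundIdeal.principal (LimitBelow t) ⟦⟨i, x⟩⟧ ≤ RoundIdeal.principal (LimitBelow t) ⟦⟨i, y⟩⟧ := by
  refine RoundIdeal.le_def.2 fun a ha => ?_
  obtain ⟨j, hj, z, rfl, hz⟩ := LimitBelow.exists_rep ha
  rw [RoundIdeal.mem_principal, DirectLimit.eq_of_le ⟨i, y⟩ j hj]
  exact .mk (hz.trans_le ((t i j hj).monotone hxy))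

/-- The canonical morphism from a member of the system to its inductive limit. -/
noncomputable def InductiveLimit.of (i : I) : CuMorphism (X i) (InductiveLimit t) where
  toFun x := RoundIdeal.principal (LimitBelow t) ⟦⟨i, x⟩⟧
  map_zero' := by rw [← DirectLimit.zero_def i]; rfl
  map_add' x y := by rw [← RoundIdeal.principal_add, DirectLimit.add_def]
  monotone' _ _ hxy := principal_mono_of_le hxy
  map_wayBelow' x y h := RoundIdeal.wayBelow_iff.2 ⟨_, LimitBelow.mk h, le_rfl⟩
  map_isLUB' z hm s hs := by
    refine (RoundIdeal.isLUB_iff fun m n h => principal_mono_of_le (hm h)).2 fun a =>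
      ⟨fun ha => ?_, fun ⟨n, hn⟩ => principal_mono_of_le (hs.1 ⟨n, rfl⟩) hn⟩
    obtain ⟨j, hj, x, rfl, hx⟩ := LimitBelow.exists_rep ha
    obtain ⟨n, hn⟩ := hx.exists_wayBelow_of_isLUB ((t i j hj).monotone.comp hm)
      ((t i j hj).map_isLUB hm hs)
    refine ⟨n, ?_⟩
    rw [RoundIdeal.mem_principal, DirectLimit.eq_of_le ⟨i, z n⟩ j hj]
    exact .mk hn

theorem InductiveLimit.isInductiveLimit : IsInductiveLimit t (InductiveLimit.of t) where
  compat i j h x := congrArg (RoundIdeal.principal (LimitBelow t))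
    (DirectLimit.mk_apply i j x h)
  dense J := by
    obtain ⟨w, -, -, hm, hJ⟩ := J.exists_principal_seq
    have h : ∀ n, ∃ p : Σ i, X i, ⟦p⟧ = w n := fun n => Quotient.exists_rep (w n)
    choose p hp using h
    have h' : (fun n => InductiveLimit.of t (p n).1 (p n).2) =
        fun n => RoundIdeal.principal (LimitBelow t) (w n) := funext fun n => by
      rw [← hp]; rfl
    exact ⟨p, h' ▸ hm, h' ▸ hJ⟩
  reflects i j x' x y h h' := by
    have hm : LimitBelow t ⟦⟨i, x'⟩⟧ ⟦⟨j, y⟩⟧ := h' (LimitBelow.mk h)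
    obtain ⟨k, hi, hj, h⟩ := hm.exists_of_mk_mk
    exact ⟨k, hi, hj, h.le⟩

end Limit

/-! ### The positive cone preserves inductive limits -/

section Positive

variable {I : Type u} [Preorder I] {X : I → Type u}
  [∀ i, AddCommMonoid (X i)] [∀ i, PartialOrder (X i)] [∀ i, IsCuStarSemigroup (X i)]
  {C : Type u} [AddCommMonoid C] [PartialOrder C] [IsCuStarSemigroup C]
  {t : ∀ i j, i ≤ j → CuMorphism (X i) (X j)} {c : ∀ i, CuMorphism (X i) C}

/-- Since `0 ≪ 0`, an element of the system whose image in the limit is positive becomes positive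
at some index. Hence a positive element of the limit is exhausted by positive elements of the
system. -/
theorem IsInductiveLimit.pos (hc : IsInductiveLimit t c) :
    IsInductiveLimit (fun i j h => (t i j h).pos) (fun i => (c i).pos) where
  compat i j h x := Subtype.ext (hc.compat i j h x)
  dense x := by
    obtain ⟨p, hp, hx⟩ := hc.dense x
    obtain ⟨k, hk⟩ := IsCuStarSemigroup.zero_compact _ hp _ hx x.2
    have hq : ∀ n, ∃ q : Σ i, PosCone (X i), c q.1 q.2 = c (p (n + k)).1 (p (n + k)).2 := fun n => by
      set m := p (n + k)
      have h0 : c m.1 0 ≤ c m.1 m.2 := by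
        rw [(c m.1).map_zero]
        exact hk.trans (hp (Nat.le_add_left k n))
      obtain ⟨j, hj, hj', h⟩ := hc.reflects _ _ 0 0 m.2 IsCuStarSemigroup.zero_compact h0
      rw [(t m.1 j hj).map_zero] at h
      exact ⟨⟨j, ⟨_, h⟩⟩, hc.compat _ _ _ _⟩
    choose q hq using hq
    refine ⟨q, fun m n hmn => ?_, (PosCone.isLUB_iff _ _).2 ?_⟩
    · change c (q m).1 (q m).2 ≤ c (q n).1 (q n).2
      rw [hq, hq]
      exact hp (Nat.add_le_add_right hmn k)
    · change IsLUB (Set.range fun n => c (q n).1 (q n).2) _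
      simp only [hq]
      exact isLUB_shift hp k _ hx
  reflects i j x' x y h hxy := hc.reflects i j x' x y ((PosCone.wayBelow_iff _ _).1 h) hxy

end Positive

section Functor

variable {I : Type u} [Preorder I]

/-- The transition morphisms of a diagram in `Cu*` indexed by a preorder. -/
def transition (F : I ⥤ CuStarCat.{u}) (i j : I) (h : i ≤ j) : CuMorphism (F.obj i) (F.obj j) :=
  F.map (homOfLE h)

instance (F : I ⥤ CuStarCat.{u}) :
    DirectedSystem (fun i => F.obj i) (transition F · · ·) where
  map_self i x := ConcreteCategory.congr_hom (F.map_id i) x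
  map_map _ _ _ hij hjk x :=
    (ConcreteCategory.congr_hom (F.map_comp (homOfLE hij) (homOfLE hjk)) x).symm

variable [IsDirectedOrder I] [Nonempty I]

/-- The cocone in `Cu*` with point the completed direct limit. -/
noncomputable def limitCocone (F : I ⥤ CuStarCat.{u}) : Cocone F where
  pt := ⟨InductiveLimit (transition F)⟩
  ι :=
    { app := fun i => InductiveLimit.of (transition F) i
      naturality := fun i j f => CuMorphism.ext fun x =>
        (InductiveLimit.isInductiveLimit (transition F)).compat i j (leOfHom f) x }

/-- `limitCocone F` is a colimit in `Cu*`. -/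
noncomputable def isColimitLimitCocone (F : I ⥤ CuStarCat.{u}) : IsColimit (limitCocone F) := by
  have hc := InductiveLimit.isInductiveLimit (transition F)
  have hs (s : Cocone F) := hc.exists_desc (D := s.pt.carrier) (f := fun i => s.ι.app i)
    (fun i j h x => ConcreteCategory.congr_hom (s.w (homOfLE h)) x)
  exact
    { desc := fun s => (hs s).choose
      fac := fun s i => CuMorphism.ext fun x => (hs s).choose_spec i x
      uniq := fun s m hm => hc.hom_ext fun i x =>
        (ConcreteCategory.congr_hom (hm i) x).trans ((hs s).choose_spec i x).symm }

/-- The positive cones of `limitCocone F` form a colimit in `Cu`. -/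
noncomputable def isColimitMapLimitCocone (F : I ⥤ CuStarCat.{u}) :
    IsColimit (nuPlus.mapCocone (limitCocone F)) := by
  have hc := (InductiveLimit.isInductiveLimit (transition F)).pos
  have hs (s : Cocone (F ⋙ nuPlus)) := hc.exists_desc (D := s.pt.carrier) (f := fun i => s.ι.app i)
    (fun i j h x => ConcreteCategory.congr_hom (s.w (homOfLE h)) x)
  exact
    { desc := fun s => (hs s).choose
      fac := fun s i => CuMorphism.ext fun x => (hs s).choose_spec i x
      uniq := fun s m hm => hc.hom_ext fun i x =>
        (ConcreteCategory.congr_hom (hm i) x).trans ((hs s).choose_spec i x).symm }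

instance : PreservesColimitsOfShape I nuPlus.{u} where
  preservesColimit {F} :=
    preservesColimit_of_preserves_colimit_cocone (isColimitLimitCocone F)
      (isColimitMapLimitCocone F)

end Functor

end CuStarTheory

/-! ### Adjoining a zero to an abelian group -/

namespace CuStarTheory

/-- The monoid `{0} ⊔ G` obtained from an abelian group `G` by adjoining a new neutral element.
As an object of `Cu*` it is ordered by the single nontrivial relation `0 ≤ 0_G`. -/
def AdjoinZero (G : Type u) : Type u := WithZero G

namespace AdjoinZero

variable {G : Type u} [AddCommGroup G]

instance : AddCommMonoid (AdjoinZero G) := inferInstanceAs (AddCommMonoid (WithZero G))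

/-- The inclusion of `G`. It is additive, but does not preserve the neutral element. -/
def of (g : G) : AdjoinZero G := (g : WithZero G)

theorem of_ne_zero (g : G) : of g ≠ 0 := WithZero.coe_ne_zero

theorem eq_zero_or_eq_of (x : AdjoinZero G) : x = 0 ∨ ∃ g, x = of g := by
  induction x using WithZero.recZeroCoe with
  | zero => exact .inl rfl
  | coe g => exact .inr ⟨g, rfl⟩

/-- The retraction onto `G` that identifies the adjoined zero with the zero of `G`. -/
def retract : AdjoinZero G →+ G where
  toFun x := WithZero.recZeroCoe 0 (fun g => g) x
  map_zero' := rfl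
  map_add' x y := by
    obtain rfl | ⟨g, rfl⟩ := eq_zero_or_eq_of x
    · rw [zero_add]; exact (zero_add _).symm
    obtain rfl | ⟨h, rfl⟩ := eq_zero_or_eq_of y
    · rw [add_zero]; exact (add_zero _).symm
    · rfl

@[simp] theorem retract_of (g : G) : retract (of g) = g := rfl

theorem add_eq_zero_iff {x y : AdjoinZero G} : x + y = 0 ↔ x = 0 ∧ y = 0 := by
  refine ⟨fun h => ?_, fun ⟨hx, hy⟩ => by rw [hx, hy, add_zero]⟩
  obtain rfl | ⟨g, rfl⟩ := eq_zero_or_eq_of x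
  · exact ⟨rfl, by rwa [zero_add] at h⟩
  obtain rfl | ⟨g', rfl⟩ := eq_zero_or_eq_of y
  · rw [add_zero] at h
    exact ⟨h, rfl⟩
  · exact (of_ne_zero _ h).elim

theorem ext' {x y : AdjoinZero G} (h0 : x = 0 ↔ y = 0) (h : retract x = retract y) : x = y := by
  obtain rfl | ⟨g, rfl⟩ := eq_zero_or_eq_of x
  · exact (h0.1 rfl).symm
  obtain rfl | ⟨g', rfl⟩ := eq_zero_or_eq_of y
  · exact h0.2 rfl
  · exact congrArg of h

instance : PartialOrder (AdjoinZero G) where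
  le x y := retract x = retract y ∧ (y = 0 → x = 0)
  le_refl _ := ⟨rfl, fun h => h⟩
  le_trans _ _ _ h h' := ⟨h.1.trans h'.1, fun hz => h.2 (h'.2 hz)⟩
  le_antisymm _ _ h h' := ext' ⟨h'.2, h.2⟩ h.1

theorem nonneg_iff {x : AdjoinZero G} : 0 ≤ x ↔ retract x = 0 :=
  ⟨fun h => h.1.symm.trans (map_zero _), fun h => ⟨(map_zero _).trans h.symm, fun _ => rfl⟩⟩

theorem exists_eventually_eq {z : ℕ → AdjoinZero G} (hz : Monotone z) :
    ∃ N, ∀ n, N ≤ n → z n = z N := by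
  by_cases h : ∃ N, z N ≠ 0
  · obtain ⟨N, hN⟩ := h
    exact ⟨N, fun n hn => (ext' ⟨fun h => (hN h).elim, fun h => (hN ((hz hn).2 h)).elim⟩
      (hz hn).1).symm⟩
  · push Not at h
    exact ⟨0, fun n _ => by rw [h, h]⟩

theorem isLUB_iff {z : ℕ → AdjoinZero G} (hz : Monotone z) {s : AdjoinZero G} :
    IsLUB (Set.range z) s ↔ ∃ N, ∀ n, N ≤ n → z n = s := by
  have h : ∀ {s}, (∃ N, ∀ n, N ≤ n → z n = s) → IsLUB (Set.range z) s := by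
    rintro s ⟨N, hN⟩
    refine ⟨?_, fun b hb => hN N le_rfl ▸ hb ⟨N, rfl⟩⟩
    rintro _ ⟨n, rfl⟩
    exact (hz (le_max_left n N)).trans (hN _ (le_max_right n N)).le
  refine ⟨fun hs => ?_, h⟩
  obtain ⟨N, hN⟩ := exists_eventually_eq hz
  rw [hs.unique (h ⟨N, hN⟩)]
  exact ⟨N, hN⟩

theorem wayBelow_of_le {x y : AdjoinZero G} (h : x ≤ y) : WayBelow x y := by
  intro z hz s hs hy
  obtain ⟨N, hN⟩ := (isLUB_iff hz).1 hs
  exact ⟨N, (h.trans hy).trans (hN N le_rfl).ge⟩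

instance : IsOrderedAddMonoid (AdjoinZero G) where
  add_le_add_left x y h z := by
    refine ⟨by rw [map_add, map_add, h.1], fun h0 => ?_⟩
    rw [add_eq_zero_iff] at h0 ⊢
    exact ⟨h.2 h0.1, h0.2⟩

instance : IsCuStarSemigroup (AdjoinZero G) where
  o1 z hz := by
    obtain ⟨N, hN⟩ := exists_eventually_eq hz
    exact ⟨z N, (isLUB_iff hz).2 ⟨N, hN⟩⟩
  o2 x := ⟨fun _ => x, fun _ => wayBelow_of_le le_rfl, by simp⟩
  o3 _ _ _ _ h h' := wayBelow_of_le (add_le_add h.le h'.le)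
  o4 x y hx hy s t hs ht := by
    rw [isLUB_iff hx] at hs
    rw [isLUB_iff hy] at ht
    rw [isLUB_iff fun m n h => add_le_add (hx h) (hy h)]
    obtain ⟨M, hM⟩ := hs
    obtain ⟨N, hN⟩ := ht
    exact ⟨max M N, fun n hn => by
      rw [hM n ((le_max_left M N).trans hn), hN n ((le_max_right M N).trans hn)]⟩
  zero_compact := wayBelow_of_le le_rfl
  pc s t ht hst := by
    rw [nonneg_iff] at ht ⊢
    rw [map_add, hst.1, ht, add_zero]
  pd s := ⟨of (-retract s), by rw [nonneg_iff, map_add, retract_of, add_neg_cancel]⟩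
  s0 _ _ h := add_eq_zero_iff.1 h

theorem isMax_of (g : G) : IsMax (of g) := fun _ h =>
  ⟨h.1.symm, fun h0 => (of_ne_zero g h0).elim⟩

section Collapse

variable {S : Type u} [AddCommMonoid S] [PartialOrder S]

/-- The morphism `S → {0} ⊔ G` that sends the elements satisfying `N` to `0` and is given by `k`
elsewhere. -/
noncomputable def collapse (k : S →+ G) (N : S → Prop) (hk : ∀ x y, x ≤ y → k x = k y)
    (zero : N 0) (add : ∀ x y, N (x + y) ↔ N x ∧ N y) (mono : ∀ x y, x ≤ y → N y → N x)
    (sup : ∀ (z : ℕ → S) (s : S), Monotone z → IsLUB (Set.range z) s → (∀ n, N (z n)) → N s)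
    (hN : ∀ x, N x → k x = 0) : CuMorphism S (AdjoinZero G) := by
  classical
  let a : S → AdjoinZero G := fun x => if N x then 0 else of (k x)
  have ha0 : ∀ x, a x = 0 ↔ N x := fun x => by
    by_cases h : N x <;> simp [a, h, of_ne_zero]
  have ha : ∀ x, retract (a x) = k x := fun x => by
    by_cases h : N x <;> simp [a, h, hN]
  have hm : Monotone a := fun x y hxy =>
    ⟨by rw [ha, ha, hk x y hxy], by rw [ha0, ha0]; exact mono x y hxy⟩
  exact
    { toFun := a
      map_zero' := (ha0 0).2 zero
      map_add' := fun x y => ext' (by rw [ha0, add_eq_zero_iff, ha0, ha0, add])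
        (by rw [ha, map_add, map_add, ha, ha])
      monotone' := hm
      map_wayBelow' := fun x y h => wayBelow_of_le (hm h.le)
      map_isLUB' := fun z hz s hs => by
        refine (isLUB_iff (hm.comp hz)).2 ?_
        by_cases h : ∀ n, N (z n)
        · exact ⟨0, fun n _ => ((ha0 _).2 (h n)).trans ((ha0 _).2 (sup z s hz hs h)).symm⟩
        · push Not at h
          obtain ⟨n, hn⟩ := h
          have hns : ¬ N s := fun h => hn (mono _ _ (hs.1 ⟨n, rfl⟩) h)
          refine ⟨n, fun m hnm => ext' ?_ ?_⟩
          · change a (z m) = 0 ↔ a s = 0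
            rw [ha0, ha0]
            exact ⟨fun h => (hn (mono _ _ (hz hnm) h)).elim, fun h => (hns h).elim⟩
          · change retract (a (z m)) = retract (a s)
            rw [ha, ha]
            exact hk _ _ (hs.1 ⟨m, rfl⟩) }

variable {k : S →+ G} {N : S → Prop} {hk zero add mono sup hN}

theorem collapse_eq_zero_iff (x : S) :
    collapse k N hk zero add mono sup hN x = 0 ↔ N x := by
  classical
  change (if N x then 0 else of (k x)) = 0 ↔ N x
  by_cases h : N x <;> simp [h, of_ne_zero]

@[simp] theorem retract_collapse (x : S) :
    retract (collapse k N hk zero add mono sup hN x) = k x := by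
  classical
  change retract (if N x then 0 else of (k x)) = k x
  by_cases h : N x <;> simp [h, hN]

end Collapse

end AdjoinZero

/-! ### Elements of a directed system that vanish in the limit -/

section Vanishing

variable {S : Type u} [AddCommMonoid S] [PartialOrder S] [IsCuStarSemigroup S]

theorem add_eq_zero_iff_of_s0 {x y : S} : x + y = 0 ↔ x = 0 ∧ y = 0 :=
  ⟨IsCuStarSemigroup.s0 x y, fun ⟨hx, hy⟩ => by rw [hx, hy, add_zero]⟩

variable {I : Type u} [Preorder I] {X : I → Type u}
  [∀ i, AddCommMonoid (X i)] [∀ i, PartialOrder (X i)]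
  (t : ∀ i j, i ≤ j → CuMorphism (X i) (X j))

/-- Every element way below `x` is sent to `0` at some index of the system. The index may depend
on the element: the elements sent to `0` themselves are not closed under suprema of increasing
sequences. -/
def Vanishes (i : I) (x : X i) : Prop :=
  ∀ x', WayBelow x' x → ∃ j, ∃ h : i ≤ j, t i j h x' = 0

namespace Vanishes

variable {t}

theorem mono {i : I} {x y : X i} (h : x ≤ y) (hy : Vanishes t i y) : Vanishes t i x :=
  fun x' hx => hy x' (hx.trans_le h)

theorem eq_zero_of_le [DirectedSystem X (t · · ·)] {i j k : I} {hij : i ≤ j} (hjk : j ≤ k)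
    {x : X i} (h : t i j hij x = 0) : t i k (hij.trans hjk) x = 0 := by
  rw [← DirectedSystem.map_map' t hij hjk, h, (t j k hjk).map_zero]

variable [∀ i, IsCuStarSemigroup (X i)]

theorem zero (i : I) : Vanishes t i 0 := fun x' hx =>
  ⟨i, le_rfl, by rw [eq_zero_of_le_zero hx.le, (t i i le_rfl).map_zero]⟩

theorem of_isLUB {i : I} {z : ℕ → X i} {s : X i} (hz : Monotone z) (hs : IsLUB (Set.range z) s)
    (h : ∀ n, Vanishes t i (z n)) : Vanishes t i s := fun x' hx => by
  obtain ⟨n, hn⟩ := hx.exists_wayBelow_of_isLUB hz hs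
  exact h n x' hn

theorem eq_zero {G : Type u} [AddCommGroup G] {k : ∀ i, X i →+ G}
    (hk : ∀ i x y, x ≤ y → k i x = k i y) (ht : ∀ i j h x, k j (t i j h x) = k i x)
    {i : I} {x : X i} (hx : Vanishes t i x) : k i x = 0 := by
  obtain ⟨z, -, -, hzx, -⟩ := exists_wayBelow_seq x
  obtain ⟨j, hj, h⟩ := hx _ (hzx 0)
  rw [← hk i _ _ (hzx 0).le, ← ht i j hj, h, map_zero]

variable [DirectedSystem X (t · · ·)] [IsDirectedOrder I]

theorem add_iff {i : I} {x y : X i} :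
    Vanishes t i (x + y) ↔ Vanishes t i x ∧ Vanishes t i y := by
  constructor
  · intro h
    have key : ∀ x' y', WayBelow x' x → WayBelow y' y →
        ∃ j, ∃ hj : i ≤ j, t i j hj x' = 0 ∧ t i j hj y' = 0 := by
      intro x' y' hx hy
      obtain ⟨j, hj, h⟩ := h _ (CuntzAxioms.o3 _ _ _ _ hx hy)
      rw [(t i j hj).map_add] at h
      exact ⟨j, hj, IsCuStarSemigroup.s0 _ _ h⟩
    obtain ⟨z, -, -, hz, -⟩ := exists_wayBelow_seq x
    obtain ⟨w, -, -, hw, -⟩ := exists_wayBelow_seq y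
    refine ⟨fun x' hx => ?_, fun y' hy => ?_⟩
    · obtain ⟨j, hj, h, -⟩ := key x' _ hx (hw 0)
      exact ⟨j, hj, h⟩
    · obtain ⟨j, hj, -, h⟩ := key _ y' (hz 0) hy
      exact ⟨j, hj, h⟩
  · rintro ⟨hx, hy⟩ x' h
    obtain ⟨a, b, ha, hb, hab⟩ := h.exists_add
    obtain ⟨j, hj, ha⟩ := hx a ha
    obtain ⟨k, hk, hb⟩ := hy b hb
    obtain ⟨l, hjl, hkl⟩ := exists_ge_ge j k
    refine ⟨l, hj.trans hjl, eq_zero_of_le_zero ?_⟩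
    refine ((t i l _).monotone hab.le).trans ?_
    rw [(t i l _).map_add, eq_zero_of_le hjl ha, eq_zero_of_le hkl hb, add_zero]

theorem map_iff {i j : I} (hij : i ≤ j) {x : X i} :
    Vanishes t j (t i j hij x) ↔ Vanishes t i x := by
  constructor
  · intro h x' hx
    obtain ⟨k, hk, h⟩ := h _ ((t i j hij).map_wayBelow hx)
    exact ⟨k, hij.trans hk, by rwa [DirectedSystem.map_map' t] at h⟩
  · intro h y hy
    obtain ⟨z, hm, -, hzx, hz⟩ := exists_wayBelow_seq x
    obtain ⟨n, hn⟩ := hy _ ((t i j hij).monotone.comp hm) _ ((t i j hij).map_isLUB hm hz) le_rfl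
    obtain ⟨k, hk, h0⟩ := h _ (hzx n)
    obtain ⟨l, hjl, hkl⟩ := exists_ge_ge j k
    refine ⟨l, hjl, eq_zero_of_le_zero (((t j l hjl).monotone hn).trans ?_)⟩
    simp only [Function.comp_apply, DirectedSystem.map_map' t, eq_zero_of_le hkl h0, le_refl]

variable {G : Type u} [AddCommGroup G] {k : ∀ i, X i →+ G}
  (hk : ∀ i x y, x ≤ y → k i x = k i y) (ht : ∀ i j h x, k j (t i j h x) = k i x)

/-- A compatible family of additive maps `X i → G`, each identifying comparable elements, lifts to
a family of morphisms `X i → {0} ⊔ G` that is again compatible, by `collapse_map`. -/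
noncomputable def collapse (i : I) : CuMorphism (X i) (AdjoinZero G) :=
  AdjoinZero.collapse (k i) (Vanishes t i) (hk i) (Vanishes.zero i)
    (fun _ _ => Vanishes.add_iff) (fun _ _ => Vanishes.mono)
    (fun _ _ hz hs h => Vanishes.of_isLUB hz hs h) (fun _ => Vanishes.eq_zero hk ht)

theorem retract_collapse (i : I) (x : X i) :
    AdjoinZero.retract (collapse hk ht i x) = k i x :=
  AdjoinZero.retract_collapse _

theorem collapse_map (i j : I) (h : i ≤ j) (x : X i) :
    collapse hk ht j (t i j h x) = collapse hk ht i x := by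
  apply AdjoinZero.ext'
  · rw [collapse, AdjoinZero.collapse_eq_zero_iff, map_iff, collapse,
      AdjoinZero.collapse_eq_zero_iff]
  · rw [retract_collapse, retract_collapse, ht]

end Vanishes

end Vanishing

end CuStarTheory

/-! ### The group of maximal elements preserves inductive limits -/

namespace CuStarMaxCat

/-- The additive map `S → S_max`, `x ↦ x + e`. -/
noncomputable def toMax (S : CuStarMaxCat.{u}) : S.obj →+ MaxElems S.obj where
  toFun x := ⟨x + ((0 : MaxElems S.obj) : S.obj), isMax_add_largest S.zero_isGreatest _⟩
  map_zero' := Subtype.ext (zero_add _)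
  map_add' x y := Subtype.ext (by
    rw [coe_add, add_add_add_comm, largest_add S.zero_isGreatest S.zero_isGreatest.1])

theorem toMax_coe (S : CuStarMaxCat.{u}) (m : MaxElems S.obj) : toMax S m = m :=
  Subtype.ext (IsMax.add_largest S.zero_isGreatest m.2)

theorem toMax_eq_of_le (S : CuStarMaxCat.{u}) {x y : S.obj} (h : x ≤ y) : toMax S x = toMax S y :=
  Subtype.ext ((toMax S x).2.eq_of_le (add_le_add_left h _))

theorem maxMap_toMax {S T : CuStarMaxCat.{u}} (α : CuMorphism S.obj T.obj) (x : S.obj) :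
    maxMap α (toMax S x) = toMax T (α x) := by
  have h : (0 : T.obj) ≤ α ((0 : MaxElems S.obj) : S.obj) :=
    α.map_zero.symm.le.trans (α.monotone S.zero_isGreatest.1)
  apply Subtype.ext
  change α (x + _) + _ = α x + _
  rw [α.map_add, add_assoc, add_comm (α ((0 : MaxElems S.obj) : S.obj)),
    largest_add T.zero_isGreatest h]

/-- The object `{0} ⊔ G` of `Cu*`, which has maximal elements. -/
def adjoinZero (G : Type u) [AddCommGroup G] : CuStarMaxCat.{u} where
  obj := ⟨AdjoinZero G⟩
  property := ⟨AdjoinZero.of 0, AdjoinZero.isMax_of 0⟩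

section

variable {S : CuStarMaxCat.{u}} {G : Type u} [AddCommGroup G]

/-- The morphism `S → {0} ⊔ G` extending a group homomorphism on `S_max`: it sends `0` to the
adjoined zero and any other element `x` to the value at `x + e`. -/
noncomputable def extend (g : MaxElems S.obj →+ G) : CuMorphism S.obj (AdjoinZero G) :=
  AdjoinZero.collapse (g.comp (toMax S)) (fun x => x = 0)
    (fun x y h => congrArg g (toMax_eq_of_le S h)) rfl (fun _ _ => add_eq_zero_iff_of_s0)
    (fun x y h hy => eq_zero_of_le_zero (hy ▸ h))
    (fun z s _ hs hz => eq_zero_of_le_zero (hs.2 (by rintro _ ⟨n, rfl⟩; exact (hz n).le)))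
    (fun x hx => by rw [hx, map_zero])

theorem extend_eq_zero_iff (g : MaxElems S.obj →+ G) (x : S.obj) : extend g x = 0 ↔ x = 0 :=
  AdjoinZero.collapse_eq_zero_iff _

theorem retract_extend (g : MaxElems S.obj →+ G) (x : S.obj) :
    AdjoinZero.retract (extend g x) = g (toMax S x) :=
  AdjoinZero.retract_collapse _

/-- Restricting a morphism into `{0} ⊔ G` to the maximal elements and identifying the two neutral
elements of `{0} ⊔ G` gives a group homomorphism. -/
noncomputable def restrict (φ : CuMorphism S.obj (AdjoinZero G)) : MaxElems S.obj →+ G where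
  toFun m := AdjoinZero.retract (φ m.1)
  map_zero' := AdjoinZero.nonneg_iff.1 (φ.map_zero.ge.trans (φ.monotone S.zero_isGreatest.1))
  map_add' m n := by rw [coe_add, φ.map_add, map_add]

theorem restrict_toMax (φ : CuMorphism S.obj (AdjoinZero G)) (x : S.obj) :
    restrict φ (toMax S x) = AdjoinZero.retract (φ x) := by
  change AdjoinZero.retract (φ (x + ((0 : MaxElems S.obj) : S.obj))) = _
  have h : AdjoinZero.retract (φ ((0 : MaxElems S.obj) : S.obj)) = 0 := (restrict φ).map_zero
  rw [φ.map_add, map_add, h, add_zero]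

end

variable {I : Type u} [Preorder I] {F : I ⥤ CuStarMaxCat.{u}}

/-- Homomorphisms on the maximal elements of a colimit extend to morphisms into `{0} ⊔ G`, to which
the universal property in `Cu*` applies. -/
theorem hom_ext_of_isColimit {c : Cocone F} (hc : IsColimit c) {G : Type u} [AddCommGroup G]
    {g g' : MaxElems c.pt.obj →+ G}
    (h : ∀ i m, g (maxMap (c.ι.app i).hom m) = g' (maxMap (c.ι.app i).hom m)) : g = g' := by
  let a : c.pt ⟶ adjoinZero G := ObjectProperty.homMk (extend g)
  let a' : c.pt ⟶ adjoinZero G := ObjectProperty.homMk (extend g')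
  have key : a = a' := hc.hom_ext fun i => ObjectProperty.hom_ext _ (CuMorphism.ext fun x => by
    let γ : CuMorphism (F.obj i).obj c.pt.obj := (c.ι.app i).hom
    change extend g (γ x) = extend g' (γ x)
    apply AdjoinZero.ext'
    · rw [extend_eq_zero_iff, extend_eq_zero_iff]
    · rw [retract_extend, retract_extend, ← maxMap_toMax]
      exact h i _)
  ext m
  rw [← toMax_coe _ m, ← retract_extend, ← retract_extend]
  exact congrArg (fun b => AdjoinZero.retract (b.hom m.1)) key

variable [IsDirectedOrder I]

/-- A cocone under the groups of maximal elements with point `G` induces morphisms to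
`{0} ⊔ G`. -/
theorem exists_cocone (s : Cocone (F ⋙ nuMax)) :
    ∃ φ : ∀ i, CuMorphism (F.obj i).obj (AdjoinZero s.pt),
      (∀ i j (f : i ⟶ j) x, φ j ((F.map f).hom x) = φ i x) ∧
      ∀ i x, AdjoinZero.retract (φ i x) = (s.ι.app i).hom (toMax (F.obj i) x) := by
  let t := transition (F ⋙ CuStarCat.hasMaximal.ι)
  let k : ∀ i, (F.obj i).obj →+ s.pt := fun i => (s.ι.app i).hom.comp (toMax (F.obj i))
  have hk : ∀ i x y, x ≤ y → k i x = k i y := fun i x y h =>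
    congrArg (s.ι.app i).hom (toMax_eq_of_le _ h)
  have ht : ∀ i j h x, k j (t i j h x) = k i x := fun i j h x =>
    (congrArg (s.ι.app j).hom (maxMap_toMax (F.map (homOfLE h)).hom x).symm).trans
      (ConcreteCategory.congr_hom (s.w (homOfLE h)) (toMax (F.obj i) x))
  have : DirectedSystem (fun i => (F.obj i).obj) (t · · ·) :=
    inferInstanceAs (DirectedSystem (fun i => (F ⋙ CuStarCat.hasMaximal.ι).obj i)
      (transition (F ⋙ CuStarCat.hasMaximal.ι) · · ·))
  exact ⟨Vanishes.collapse hk ht, fun i j f x => Vanishes.collapse_map hk ht i j (leOfHom f) x,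
    fun i x => Vanishes.retract_collapse hk ht i x⟩

theorem exists_desc {c : Cocone F} (hc : IsColimit c) (s : Cocone (F ⋙ nuMax)) :
    ∃ g : MaxElems c.pt.obj →+ s.pt, ∀ i m,
      g (maxMap (c.ι.app i).hom m) = (s.ι.app i).hom m := by
  obtain ⟨φ, hφ, hr⟩ := exists_cocone s
  let s' : Cocone F :=
    { pt := adjoinZero s.pt
      ι :=
        { app := fun i => ObjectProperty.homMk (φ i)
          naturality := fun i j f =>
            ObjectProperty.hom_ext _ (CuMorphism.ext fun x => hφ i j f x) } }
  let ψ : CuMorphism c.pt.obj (AdjoinZero s.pt) := (hc.desc s').hom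
  refine ⟨restrict ψ, fun i m => ?_⟩
  let γ : CuMorphism (F.obj i).obj c.pt.obj := (c.ι.app i).hom
  have h : ψ (γ m.1) = φ i m.1 :=
    ConcreteCategory.congr_hom (congrArg (·.hom) (hc.fac s' i)) m.1
  calc restrict ψ (maxMap γ m) = restrict ψ (maxMap γ (toMax _ m.1)) := by rw [toMax_coe]
    _ = AdjoinZero.retract (ψ (γ m.1)) := by rw [maxMap_toMax, restrict_toMax]
    _ = (s.ι.app i).hom (toMax _ m.1) := by rw [h, hr]
    _ = (s.ι.app i).hom m := congrArg (s.ι.app i).hom (toMax_coe _ m)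

instance : PreservesColimitsOfShape I nuMax.{u} where
  preservesColimit {F} :=
    { preserves := fun {c} hc => by
        have hd := exists_desc hc
        exact ⟨{ desc := fun s => AddCommGrpCat.ofHom (hd s).choose
                 fac := fun s i => AddCommGrpCat.hom_ext (AddMonoidHom.ext fun m =>
                   (hd s).choose_spec i m)
                 uniq := fun s m hm => AddCommGrpCat.hom_ext (hom_ext_of_isColimit hc fun i x =>
                   (ConcreteCategory.congr_hom (hm i) x).trans
                     ((hd s).choose_spec i x).symm) }⟩ }

end CuStarMaxCat

theorem mainTheorem9 :
    -- `ν_+` sends `α : S ⟶ T` to its restriction `S_+ → T_+`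
    (∀ (S T : CuStarCat.{u}) (α : S ⟶ T) (x : PosCone S),
      (nuPlus.map α x : PosCone T).1 = α x.1) ∧
    -- `S_max` is a group under the addition of `S`, with neutral element the largest element of
    -- `S_+`, and `ν_max` sends `α : S ⟶ T` to `x ↦ α x + e_{T_max}`
    (∀ S : CuStarMaxCat.{u},
      (∀ x y : nuMax.obj S, ((x + y : nuMax.obj S) : MaxElems S.obj).1 = (x : MaxElems S.obj).1 + y.1) ∧
      IsGreatest {s : S.obj | 0 ≤ s} ((0 : nuMax.obj S) : MaxElems S.obj).1) ∧
    (∀ (S T : CuStarMaxCat.{u}) (α : S ⟶ T) (x : MaxElems S.obj),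
      (nuMax.map α x : MaxElems T.obj).1
        = α.hom x.1 + ((0 : nuMax.obj T) : MaxElems T.obj).1) ∧
    -- both functors preserve inductive limits over arbitrary directed index sets
    (∀ (I : Type u) [Preorder I] [IsDirectedOrder I] [Nonempty I],
      PreservesColimitsOfShape I nuPlus.{u} ∧ PreservesColimitsOfShape I nuMax.{u}) := by
  exact ⟨fun _ _ _ _ => rfl, fun S => ⟨fun _ _ => rfl, S.zero_isGreatest⟩, fun _ _ _ _ => rfl,
    fun _ _ _ _ => ⟨inferInstance, inferInstance⟩⟩
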